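/- Let $(M,g)$ be a (smooth) Riemannian manifold with Levi-Civita connection $\nabla^g$ on $TM$; the induced connection on $T^*M$ (transported by the musical isomorphism, $\nabla^g_X\theta=\flat(\nabla^g_X\sharp\theta)$) is also denoted $\nabla^g$, and $g$ also denotes the induced metric on $T^*M$. A *Clifford module* over $M$ is a $\mathbb Z/2$-graded complex vector bundle $E=E_0\oplus E_1$ of finite rank over $M$ with a hermitian metric $h$ (a smooth family of nondegenerate hermitian forms) and a smooth Clifford multiplication $c\colon T^*M\to \mathrm{End}_{\mathbb C}(E)$, linear in the fibres, such that (a) $c(\theta_1)c(\theta_2)+c(\theta_2)c(\theta_1)=-2g(\theta_1,\theta_2)$ for all covectors $\theta_1,\theta_2$ at a common point; (b) $h(c(\theta)\psi_1,\psi_2)+h(\psi_1,c(\theta)\psi_2)=0$ for all covectors $\theta$ with $g(\theta,\theta)=1$; (c) $c(\theta)$ is odd, i.e. it exchanges $E_0$ and $E_1$. A *Dirac bundle* is a Clifford module $E$ with a Clifford connection, that is, a ($\mathbb C$-linear) connection $\nabla^E$ on $E$ which is metric for $h$ and satisfies $$\nabla^E_X(c(\theta)\psi)=c(\nabla^g_X\theta)\psi+c(\theta)\nabla^E_X\psi$$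 for all $X\in\Gamma(TM)$, $\theta\in\Gamma(T^*M)$, $\psi\in\Gamma(E)$. For a connection $\nabla$ write $F^{\nabla}(X,Y)=\nabla_X\nabla_Y-\nabla_Y\nabla_X-\nabla_{[X,Y]}$ for its curvature. For $x\in M$ let $\mathrm{Cl}(T_x^*M)$ be the Clifford algebra generated by $T_x^*M$ with the relations $v^2=-g(v,v)$, and let $\mathfrak{spin}(T_x^*M)\subset \mathrm{Cl}(T_x^*M)$ be the span of the commutators $[v,w]$, $v,w\in T_x^*M$. Let $$\rho_*\colon \mathfrak{spin}(T_x^*M)\to\mathfrak{so}(T_x^*M),\qquad \rho_*(a)v=[a,v],$$ be the differential of $\rho(x)v=xvx^{-1}$; it is an isomorphism onto the skew-adjoint endomorphisms of $T_x^*M$. The Riemann curvature $R^g(X,Y)=F^{\nabla^g}(X,Y)$, acting on $T^*M$ through the musical isomorphism, takes values in $\mathfrak{so}(T^*M)$. Extend $c$ to an algebra homomorphism $c\colon\mathrm{Cl}(T_x^*M)\to\mathrm{End}(E_x)$. The *twisting curvature* of the Dirac bundle $(E,\nabla^E)$ is $$F^{E/S}(X,Y)=F^{\nabla^E}(X,Y)-c\big(\rho_*^{-1}(R^g(X,Y))\big).$$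 **Proposition.** For every Dirac bundle $(E,\nabla^E)$ over $(M,g)$ and all $X,Y\in\Gamma(TM)$, $\theta\in\Gamma(T^*M)$, the operator $F^{E/S}(X,Y)$ commutes with $c(\theta)$: $$F^{E/S}(X,Y)\,c(\theta)\psi=c(\theta)\,F^{E/S}(X,Y)\psi\qquad\text{for all }\psi\in\Gamma(E).$$ -/

import Mathlib

open Bundle
open scoped Manifold ContDiff

noncomputable section

namespace DiracGeom

section CliffordAlgebraPart

variable {W : Type*} [AddCommGroup W] [Module ℝ W]

/-- The quadratic form `v ↦ -B(v, v)`; its Clifford algebra is the algebra `Cl(W, B)`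
generated by `W` with the relations `v * v = -B(v, v)`. -/
def cliffordForm (B : LinearMap.BilinForm ℝ W) : QuadraticForm ℝ W := -B.toQuadraticMap

theorem cliffordForm_apply (B : LinearMap.BilinForm ℝ W) (v : W) :
    cliffordForm B v = -B v v := rfl

/-- The Clifford algebra with the sign convention `v * v = -B(v, v)`. -/
abbrev Cl (B : LinearMap.BilinForm ℝ W) : Type _ := CliffordAlgebra (cliffordForm B)

/-- The inclusion of `W` into its Clifford algebra. -/
abbrev clι (B : LinearMap.BilinForm ℝ W) : W →ₗ[ℝ] Cl B := CliffordAlgebra.ι (cliffordForm B)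

theorem clι_mul_add_swap (B : LinearMap.BilinForm ℝ W) (hB : B.IsSymm) (v w : W) :
    clι B v * clι B w + clι B w * clι B v = algebraMap ℝ (Cl B) (-2 * B v w) := by
  rw [CliffordAlgebra.ι_mul_ι_add_swap]
  congr 1
  have h := hB.eq v w
  simp only [QuadraticMap.polar, cliffordForm_apply, map_add, LinearMap.add_apply]
  linarith

theorem clι_injective (B : LinearMap.BilinForm ℝ W) : Function.Injective (clι B) := by
  intro v w h
  have h' := congrArg (CliffordAlgebra.equivExterior (cliffordForm B)) h
  simp only [CliffordAlgebra.equivExterior, CliffordAlgebra.changeFormEquiv_apply,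
    CliffordAlgebra.changeForm_ι] at h'
  exact ExteriorAlgebra.ι_leftInverse.injective h'

theorem lie_lie_clι (B : LinearMap.BilinForm ℝ W) (hB : B.IsSymm) (v w x : W) :
    ⁅⁅clι B v, clι B w⁆, clι B x⁆ = clι B ((4 * B v x) • w - (4 * B w x) • v) := by
  have h1 := clι_mul_add_swap B hB v x
  have h2 := clι_mul_add_swap B hB w x
  rw [Algebra.algebraMap_eq_smul_one] at h1 h2
  simp only [Ring.lie_def, map_sub, map_smul]
  generalize clι B v = a at *
  generalize clι B w = b at *
  generalize clι B x = c at *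
  have e1 : a * c = (-2 * B v x) • (1 : Cl B) - c * a := eq_sub_of_add_eq h1
  have e2 : b * c = (-2 * B w x) • (1 : Cl B) - c * b := eq_sub_of_add_eq h2
  have k1 : a * b * c = (-2 * B w x) • a - (-2 * B v x) • b + c * (a * b) := by
    rw [mul_assoc, e2, mul_sub, ← mul_assoc, e1, sub_mul, mul_smul_comm, smul_mul_assoc,
      mul_one, one_mul, mul_assoc]
    abel
  have k2 : b * a * c = (-2 * B v x) • b - (-2 * B w x) • a + c * (b * a) := by
    rw [mul_assoc, e1, mul_sub, ← mul_assoc, e2, sub_mul, mul_smul_comm, smul_mul_assoc,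
      mul_one, one_mul, mul_assoc]
    abel
  rw [sub_mul, mul_sub, k1, k2]
  module

/-- The Lie algebra of the spin group, as a linear subspace of the Clifford algebra: the span of
the commutators `⁅v, w⁆` of vectors. In terms of an orthogonal basis, it is the span of the
products `e_i * e_j` with `i ≠ j`. -/
def spinLie (B : LinearMap.BilinForm ℝ W) : Submodule ℝ (Cl B) :=
  Submodule.span ℝ (Set.range fun p : W × W => ⁅clι B p.1, clι B p.2⁆)

theorem lie_mem_spinLie (B : LinearMap.BilinForm ℝ W) (v w : W) :
    ⁅clι B v, clι B w⁆ ∈ spinLie B := Submodule.subset_span ⟨(v, w), rfl⟩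

theorem exists_skew_of_mem_spinLie (B : LinearMap.BilinForm ℝ W) (hB : B.IsSymm) (a : Cl B)
    (ha : a ∈ spinLie B) :
    ∃ A ∈ B.skewAdjointSubmodule, ∀ v, clι B (A v) = ⁅a, clι B v⁆ := by
  induction ha using Submodule.span_induction with
  | mem a h =>
    obtain ⟨⟨v, w⟩, rfl⟩ := h
    refine ⟨(4 : ℝ) • ((B v).smulRight w - (B w).smulRight v), ?_, fun x => ?_⟩
    · rw [LinearMap.mem_skewAdjointSubmodule]
      intro x y
      have h1 := hB.eq v x
      have h2 := hB.eq w x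
      simp
      rw [← h1, ← h2]
      ring
    · rw [lie_lie_clι B hB]
      congr 1
      simp [smul_sub, smul_smul]
  | zero => exact ⟨0, zero_mem _, fun v => by simp [Ring.lie_def]⟩
  | add a b _ _ iha ihb =>
    obtain ⟨A, hA, hA'⟩ := iha
    obtain ⟨A2, hA2, hA2'⟩ := ihb
    refine ⟨A + A2, add_mem hA hA2, fun v => ?_⟩
    rw [LinearMap.add_apply, map_add, hA', hA2']
    simp only [Ring.lie_def, add_mul, mul_add]
    abel
  | smul r a _ iha =>
    obtain ⟨A, hA, hA'⟩ := iha
    refine ⟨r • A, Submodule.smul_mem _ r hA, fun v => ?_⟩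
    rw [LinearMap.smul_apply, map_smul, hA']
    simp only [Ring.lie_def, smul_mul_assoc, mul_smul_comm, smul_sub]

/-- The map `ρ_* : spin(W) → so(W)`, the differential of `ρ(x) v = x v x⁻¹`. It is given by
`ρ_*(a) v = ⁅a, v⁆`, the commutator in the Clifford algebra. -/
def rhoStarHom (B : LinearMap.BilinForm ℝ W) (hB : B.IsSymm) :
    spinLie B →ₗ[ℝ] B.skewAdjointSubmodule where
  toFun a := ⟨(exists_skew_of_mem_spinLie B hB a a.2).choose,
    (exists_skew_of_mem_spinLie B hB a a.2).choose_spec.1⟩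
  map_add' a b := by
    ext v
    apply clι_injective B
    have ha := (exists_skew_of_mem_spinLie B hB a a.2).choose_spec.2 v
    have hb := (exists_skew_of_mem_spinLie B hB b b.2).choose_spec.2 v
    have hab := (exists_skew_of_mem_spinLie B hB (a + b : spinLie B) (a + b).2).choose_spec.2 v
    refine hab.trans (Eq.trans ?_ (map_add (clι B) _ _).symm)
    refine Eq.trans ?_ (congrArg₂ (· + ·) ha hb).symm
    simp only [Submodule.coe_add]
    simp only [Ring.lie_def, add_mul, mul_add]
    abel
  map_smul' r a := by
    ext v
    apply clι_injective B
    have ha := (exists_skew_of_mem_spinLie B hB a a.2).choose_spec.2 v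
    have hra := (exists_skew_of_mem_spinLie B hB (r • a : spinLie B) (r • a).2).choose_spec.2 v
    refine hra.trans (Eq.trans ?_ (map_smul (clι B) r _).symm)
    refine Eq.trans ?_ (congrArg (r • ·) ha).symm
    simp only [Submodule.coe_smul]
    simp only [Ring.lie_def, smul_mul_assoc, mul_smul_comm, smul_sub]

theorem clι_rhoStarHom (B : LinearMap.BilinForm ℝ W) (hB : B.IsSymm) (a : spinLie B) (v : W) :
    clι B ((rhoStarHom B hB a : Module.End ℝ W) v) = ⁅(a : Cl B), clι B v⁆ :=
  (exists_skew_of_mem_spinLie B hB a a.2).choose_spec.2 v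

theorem rhoStarHom_bijective [FiniteDimensional ℝ W] (B : LinearMap.BilinForm ℝ W)
    (hB : B.IsSymm) (hB' : B.Nondegenerate) : Function.Bijective (rhoStarHom B hB) := by
  let b := Module.finBasis ℝ W
  let d := B.dualBasis hB' b
  have hsymm : ∀ v w, B v w = B w v := fun v w => by simpa using hB.eq v w
  have hd : ∀ w, ∑ i, B w (b i) • d i = w := fun w => by
    conv_rhs => rw [← d.sum_repr w]
    refine Finset.sum_congr rfl fun i _ => ?_
    rw [LinearMap.BilinForm.dualBasis_repr_apply]
  have hb : ∀ w, ∑ i, B w (d i) • b i = w := fun w => by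
    have hdd := LinearMap.BilinForm.dualBasis_dualBasis hB' hB b
    conv_rhs => rw [← (B.dualBasis hB' d).sum_repr w]
    refine Finset.sum_congr rfl fun i _ => ?_
    rw [LinearMap.BilinForm.dualBasis_repr_apply, hdd]
  let inv : Module.End ℝ W →ₗ[ℝ] Cl B := (1 / 8 : ℝ) •
    ∑ i, (LinearMap.mulLeft ℝ (clι B (d i)) - LinearMap.mulRight ℝ (clι B (d i))) ∘ₗ
      clι B ∘ₗ LinearMap.applyₗ (b i)
  have hinv : ∀ A, inv A = (1 / 8 : ℝ) • ∑ i, ⁅clι B (d i), clι B (A (b i))⁆ := fun A => by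
    simp [inv, Ring.lie_def]
  have hsum : ∀ v w : W, ∑ i, (B v (b i)) • ⁅clι B (d i), clι B w⁆ = ⁅clι B v, clι B w⁆ := by
    intro v w
    conv_rhs => rw [← hd v]
    simp only [Ring.lie_def, map_sum, map_smul, Finset.sum_mul, Finset.mul_sum,
      ← Finset.sum_sub_distrib, smul_mul_assoc, mul_smul_comm, smul_sub]
  have hleft : ∀ a : spinLie B, inv (rhoStarHom B hB a : Module.End ℝ W) = a := by
    rintro ⟨a, ha⟩
    induction ha using Submodule.span_induction with
    | mem a h =>
      obtain ⟨⟨v, w⟩, rfl⟩ := h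
      rw [hinv]
      have key : ∀ i, clι B ((rhoStarHom B hB ⟨⁅clι B v, clι B w⁆,
          lie_mem_spinLie B v w⟩ : Module.End ℝ W) (b i))
          = clι B ((4 * B v (b i)) • w - (4 * B w (b i)) • v) := fun i => by
        rw [clι_rhoStarHom, lie_lie_clι B hB]
      have key2 : ∀ i, ⁅clι B (d i), clι B ((4 * B v (b i)) • w - (4 * B w (b i)) • v)⁆
          = (4 : ℝ) • (B v (b i) • ⁅clι B (d i), clι B w⁆)
            - (4 : ℝ) • (B w (b i) • ⁅clι B (d i), clι B v⁆) := fun i => by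
        simp only [Ring.lie_def, map_sub, map_smul, mul_sub, sub_mul, smul_mul_assoc,
          mul_smul_comm, smul_sub, smul_smul]
        abel
      rw [Finset.sum_congr rfl fun i _ => by rw [key i, key2 i], Finset.sum_sub_distrib,
        ← Finset.smul_sum, ← Finset.smul_sum, hsum, hsum]
      simp only [Ring.lie_def]
      module
    | zero =>
      have : (⟨0, zero_mem _⟩ : spinLie B) = 0 := rfl
      rw [this, map_zero, Submodule.coe_zero, map_zero, Submodule.coe_zero]
    | add x y hx hy ihx ihy =>
      have : (⟨x + y, add_mem hx hy⟩ : spinLie B) = ⟨x, hx⟩ + ⟨y, hy⟩ := rfl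
      rw [this, map_add, Submodule.coe_add, map_add, ihx, ihy, Submodule.coe_add]
    | smul r x hx ihx =>
      have : (⟨r • x, Submodule.smul_mem _ r hx⟩ : spinLie B) = r • ⟨x, hx⟩ := rfl
      rw [this, map_smul, Submodule.coe_smul, map_smul, ihx, Submodule.coe_smul]
  constructor
  · intro x y hxy
    apply Subtype.ext
    rw [← hleft x, ← hleft y, hxy]
  · rintro ⟨A, hA⟩
    have hA' : ∀ x y, B (A x) y = - B x (A y) := fun x y => by
      have := (LinearMap.mem_skewAdjointSubmodule A).1 hA x y
      simpa using this
    have hmem : inv A ∈ spinLie B := by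
      rw [hinv]
      exact Submodule.smul_mem _ _ (Submodule.sum_mem _ fun i _ => lie_mem_spinLie B _ _)
    refine ⟨⟨inv A, hmem⟩, ?_⟩
    ext v
    apply clι_injective B
    rw [clι_rhoStarHom]
    have e1 : ∑ i, B v (d i) • A (b i) = A v := by
      conv_rhs => rw [← hb v]
      simp
    have e2 : ∑ i, B (A (b i)) v • d i = - A v := by
      conv_rhs => rw [← hd (A v)]
      rw [← Finset.sum_neg_distrib]
      refine Finset.sum_congr rfl fun i _ => ?_
      rw [hA', hsymm, neg_smul]
    have e3 : ⁅inv A, clι B v⁆ = (1 / 8 : ℝ) • ∑ i, ⁅⁅clι B (d i), clι B (A (b i))⁆, clι B v⁆ := by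
      rw [hinv]
      generalize hf : (fun i => ⁅clι B (d i), clι B (A (b i))⁆) = f
      have hf' : ∀ i, ⁅clι B (d i), clι B (A (b i))⁆ = f i := fun i => by rw [← hf]
      simp only [hf']
      simp only [Ring.lie_def, Finset.sum_mul, Finset.mul_sum,
        smul_mul_assoc, mul_smul_comm, Finset.sum_sub_distrib, smul_sub]
    change ⁅inv A, clι B v⁆ = clι B (A v)
    rw [e3]
    simp only [lie_lie_clι B hB]
    rw [← map_sum, ← map_smul]
    congr 1
    simp only [Finset.sum_sub_distrib, mul_smul, ← Finset.smul_sum]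
    rw [e2]
    simp only [fun i => hsymm (d i) v, e1]
    module

/-- The Lie algebra isomorphism `ρ_* : spin(W) ≃ so(W)`. -/
def rhoStar [FiniteDimensional ℝ W] (B : LinearMap.BilinForm ℝ W)
    (hB : B.IsSymm) (hB' : B.Nondegenerate) : spinLie B ≃ₗ[ℝ] B.skewAdjointSubmodule :=
  LinearEquiv.ofBijective (rhoStarHom B hB) (rhoStarHom_bijective B hB hB')

theorem clι_rhoStar [FiniteDimensional ℝ W] (B : LinearMap.BilinForm ℝ W)
    (hB : B.IsSymm) (hB' : B.Nondegenerate) (a : spinLie B) (v : W) :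
    clι B ((rhoStar B hB hB' a : Module.End ℝ W) v) = ⁅(a : Cl B), clι B v⁆ :=
  clι_rhoStarHom B hB a v

/-- On a commutator of vectors, `ρ_*(⁅v, w⁆) x = 4 (B(v, x) w - B(w, x) v)`. -/
theorem rhoStar_lie [FiniteDimensional ℝ W] (B : LinearMap.BilinForm ℝ W)
    (hB : B.IsSymm) (hB' : B.Nondegenerate) (v w x : W) :
    (rhoStar B hB hB' ⟨⁅clι B v, clι B w⁆, lie_mem_spinLie B v w⟩ : Module.End ℝ W) x
      = (4 : ℝ) • (B v x • w - B w x • v) := by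
  apply clι_injective B
  rw [clι_rhoStar, lie_lie_clι B hB]
  congr 1
  module

end CliffordAlgebraPart

section Connections

variable {E : Type*} [NormedAddCommGroup E] [NormedSpace ℝ E]
  {H : Type*} [TopologicalSpace H] {I : ModelWithCorners ℝ E H}
  {M : Type*} [TopologicalSpace M] [ChartedSpace H M]
  {F : Type*} [NormedAddCommGroup F] [NormedSpace ℝ F]
  {V : M → Type*} [TopologicalSpace (TotalSpace F V)]
  [∀ x, AddCommGroup (V x)] [∀ x, Module ℝ (V x)] [∀ x, TopologicalSpace (V x)]
  [∀ x, IsTopologicalAddGroup (V x)] [∀ x, ContinuousSMul ℝ (V x)]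
  [FiberBundle F V]

/-- The operator `∇_X` on sections associated with a covariant derivative and a vector field. -/
def nabla (cov : CovariantDerivative I F V) (X : ∀ x : M, TangentSpace I x) (σ : ∀ x, V x) :
    ∀ x, V x := fun x => cov σ x (X x)

/-- The curvature `F(X, Y) σ = ∇_X ∇_Y σ - ∇_Y ∇_X σ - ∇_[X, Y] σ`. -/
def curvature (cov : CovariantDerivative I F V) (X Y : ∀ x : M, TangentSpace I x)
    (σ : ∀ x, V x) : ∀ x, V x :=
  nabla cov X (nabla cov Y σ) - nabla cov Y (nabla cov X σ)
    - nabla cov (VectorField.mlieBracket I X Y) σ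

end Connections

section Sections

variable {E : Type*} [NormedAddCommGroup E] [NormedSpace ℝ E]
  {H : Type*} [TopologicalSpace H] (I : ModelWithCorners ℝ E H)
  (M : Type*) [TopologicalSpace M] [ChartedSpace H M] [IsManifold I ∞ M]

/-- Smooth vector fields. -/
abbrev VectorFields : Type _ := Cₛ^∞⟮I; E, (TangentSpace I : M → Type _)⟯

/-- Smooth one-forms. -/
abbrev OneForms : Type _ := Cₛ^∞⟮I; E →L[ℝ] ℝ, fun x : M => TangentSpace I x →L[ℝ] ℝ⟯

end Sections

section Riemannian

variable {E : Type*} [NormedAddCommGroup E] [NormedSpace ℝ E] [FiniteDimensional ℝ E]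
  {H : Type*} [TopologicalSpace H] {I : ModelWithCorners ℝ E H}
  {M : Type*} [TopologicalSpace M] [ChartedSpace H M]

instance (x : M) : FiniteDimensional ℝ (TangentSpace I x) :=
  inferInstanceAs (FiniteDimensional ℝ E)

variable [RiemannianBundle (fun (x : M) ↦ TangentSpace I x)]

instance (x : M) : CompleteSpace (TangentSpace I x) := FiniteDimensional.complete ℝ _

variable (I) in
/-- The musical isomorphism `♭ : T_x M ≃ T_x^* M`, `v ↦ ⟪v, ·⟫`. -/
def flat (x : M) :
    TangentSpace I x ≃ₗ[ℝ] (TangentSpace I x →L[ℝ] ℝ) where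
  __ := (InnerProductSpace.toDual ℝ (TangentSpace I x)).toLinearEquiv

theorem flat_apply (x : M) (v w : TangentSpace I x) : flat I x v w = inner ℝ v w := rfl

instance (x : M) : FiniteDimensional ℝ (TangentSpace I x →L[ℝ] ℝ) :=
  (flat I x).finiteDimensional

variable (I) in
/-- The metric on `T_x^* M` induced by the Riemannian metric:
`g(α, β) = ⟪♯α, ♯β⟫`. -/
def cometric (x : M) :
    LinearMap.BilinForm ℝ (TangentSpace I x →L[ℝ] ℝ) :=
  (innerₗ (TangentSpace I x)).compl₁₂ (flat I x).symm.toLinearMap (flat I x).symm.toLinearMap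

theorem cometric_apply (x : M) (α β : TangentSpace I x →L[ℝ] ℝ) :
    cometric I x α β = inner ℝ ((flat I x).symm α) ((flat I x).symm β) := rfl

theorem cometric_isSymm (x : M) : (cometric I x).IsSymm :=
  ⟨fun α β => by simp only [cometric_apply]; exact real_inner_comm _ _⟩

theorem cometric_nondegenerate (x : M) : (cometric I x).Nondegenerate := by
  refine (cometric_isSymm x).isRefl.nondegenerate_iff_separatingLeft.2 fun α h => ?_
  have := h α
  rw [cometric_apply, inner_self_eq_zero] at this
  simpa using this


variable [IsManifold I ∞ M] [IsContMDiffRiemannianBundle I ∞ E (fun (x : M) ↦ TangentSpace I x)]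

variable (I M) in
/-- A Levi-Civita connection: a smooth covariant derivative on `TM` that is metric and
torsion-free. -/
structure LeviCivitaConnection where
  /-- the covariant derivative `∇^g` -/
  cov : CovariantDerivative I E (TangentSpace I : M → Type _)
  smooth : CovariantDerivative.ContMDiffCovariantDerivative cov ∞
  metric : ∀ X Y Z : VectorFields I M, ∀ x : M,
    mvfderiv I (fun y => inner ℝ (Y y) (Z y)) x (X x)
      = inner ℝ (nabla cov X Y x) (Z x) + inner ℝ (Y x) (nabla cov X Z x)
  torsion : cov.torsion = 0

variable (I) in
/-- The vector field `♯θ` dual to a one-form. -/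
def sharp (θ : ∀ x : M, TangentSpace I x →L[ℝ] ℝ) (x : M) : TangentSpace I x :=
  (flat I x).symm (θ x)

/-- The connection induced on `T^*M` by a connection on `TM` through the musical isomorphism:
`∇_X θ = ♭(∇_X ♯θ)`. -/
def cotNabla (cov : CovariantDerivative I E (TangentSpace I : M → Type _))
    (X : ∀ x : M, TangentSpace I x) (θ : ∀ x : M, TangentSpace I x →L[ℝ] ℝ) (x : M) :
    TangentSpace I x →L[ℝ] ℝ :=
  flat I x (nabla cov X (sharp I θ) x)

end Riemannian


section Smoothness

variable {E : Type*} [NormedAddCommGroup E] [NormedSpace ℝ E]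
  {H : Type*} [TopologicalSpace H] {I : ModelWithCorners ℝ E H}
  {M : Type*} [TopologicalSpace M] [ChartedSpace H M] [IsManifold I ∞ M]

theorem contMDiff_nabla (cov : CovariantDerivative I E (TangentSpace I : M → Type _))
    (hcov : CovariantDerivative.ContMDiffCovariantDerivative cov ∞)
    (X Y : VectorFields I M) :
    ContMDiff I (I.prod 𝓘(ℝ, E)) ∞
      (fun y => TotalSpace.mk' E (E := (TangentSpace I : M → Type _)) y (nabla cov X Y y)) := by
  have h := hcov.contMDiff.contMDiff (σ := Y) (by
    rw [contMDiffOn_univ]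
    exact Y.contMDiff)
  rw [contMDiffOn_univ] at h
  exact ContMDiff.clm_bundle_apply h X.contMDiff

theorem contMDiff_dirDeriv (X : VectorFields I M)
    (f : M → ℝ) (hf : ContMDiff I 𝓘(ℝ, ℝ) ∞ f) :
    ContMDiff I 𝓘(ℝ, ℝ) ∞ (fun y => mvfderiv I f y (X y)) := by
  have h := (hf.contMDiff_tangentMap (m := ∞) le_rfl).comp X.contMDiff
  exact (contMDiff_snd_tangentBundle_modelSpace ℝ 𝓘(ℝ, ℝ)).comp h

theorem isManifold_minSmoothness (k : ℕ) :
    IsManifold I (minSmoothness ℝ (k : WithTop ℕ∞)) M := by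
  rw [minSmoothness_of_isRCLikeNormedField]
  exact IsManifold.of_le (n := ∞) (by exact_mod_cast le_top)

theorem nabla_add (cov : CovariantDerivative I E (TangentSpace I : M → Type _))
    (X Y Z : VectorFields I M) :
    nabla cov X ⇑(Y + Z) = nabla cov X Y + nabla cov X Z := by
  ext x
  have h := cov.isCovariantDerivativeOnUniv.add (x := x) (σ := Y) (σ' := Z)
    ((Y.contMDiff x).mdifferentiableAt (by simp)) ((Z.contMDiff x).mdifferentiableAt (by simp))
  simpa [nabla] using! congrArg (fun L => L (X x)) h

theorem nabla_smul (cov : CovariantDerivative I E (TangentSpace I : M → Type _))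
    (X Y : VectorFields I M) (r : ℝ) :
    nabla cov X ⇑(r • Y) = r • nabla cov X Y := by
  ext x
  have h := cov.isCovariantDerivativeOnUniv.smul_const (x := x) (σ := Y) r
    ((Y.contMDiff x).mdifferentiableAt (by simp))
  simpa [nabla] using! congrArg (fun L => L (X x)) h

end Smoothness

section Extension

variable {E : Type*} [NormedAddCommGroup E] [NormedSpace ℝ E] [FiniteDimensional ℝ E]
  {H : Type*} [TopologicalSpace H] {I : ModelWithCorners ℝ E H}
  {M : Type*} [TopologicalSpace M] [ChartedSpace H M] [IsManifold I ∞ M] [T2Space M]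

theorem exists_bump (x : M) : ∃ χ : SmoothBumpFunction I x,
    tsupport χ ⊆ (trivializationAt E (TangentSpace I : M → Type _) x).baseSet := by
  have h := (trivializationAt E (TangentSpace I : M → Type _) x).open_baseSet.mem_nhds
    (FiberBundle.mem_baseSet_trivializationAt' x)
  obtain ⟨χ, -, hχ⟩ := (SmoothBumpFunction.nhds_basis_tsupport (I := I) x).mem_iff.1 h
  exact ⟨χ, hχ⟩

variable (I) in
/-- A smooth vector field with value `v` at `x`: constant in a trivialization, multiplied by
a bump function. -/
def extendVec (x : M) (v : TangentSpace I x) (y : M) : TangentSpace I y :=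
  (exists_bump (I := I) x).choose y • FiberBundle.extend E v y

theorem extendVec_self (x : M) (v : TangentSpace I x) : extendVec I x v x = v := by
  simp [extendVec]

theorem contMDiff_extendVec (x : M) (v : TangentSpace I x) :
    ContMDiff I (I.prod 𝓘(ℝ, E)) ∞
      (fun y => TotalSpace.mk' E (E := (TangentSpace I : M → Type _)) y (extendVec I x v y)) := by
  set t := trivializationAt E (TangentSpace I : M → Type _) x with ht
  refine ContMDiffOn.smul_section_of_tsupport (u := t.baseSet)
    (SmoothBumpFunction.contMDiff _).contMDiffOn t.open_baseSet (exists_bump (I := I) x).choose_spec ?_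
  suffices ContMDiffOn I 𝓘(ℝ, E) ∞ (fun y => (t ⟨y, FiberBundle.extend E v y⟩).2) t.baseSet by
    intro y hy
    rw [t.contMDiffWithinAt_section _ hy]
    exact this y hy
  have : ContMDiffOn I 𝓘(ℝ, E) ∞ (fun _ : M => (t ⟨x, v⟩).2) t.baseSet := contMDiffOn_const
  exact this.congr (fun y hy => by 
    simp only [FiberBundle.extend]
    rw [← ht, t.apply_mk_symm hy])

variable (I) in
/-- `extendVec` as a smooth section depending linearly on the vector. -/
def extendSec (x : M) :
    TangentSpace I x →ₗ[ℝ] VectorFields I M where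
  toFun v := ⟨extendVec I x v, contMDiff_extendVec x v⟩
  map_add' v w := by
    ext y
    have hx := FiberBundle.mem_baseSet_trivializationAt E (TangentSpace I : M → Type _) x
    have h := ((trivializationAt E (TangentSpace I : M → Type _) x).linear ℝ hx).map_add v w
    change extendVec I x (v + w) y = extendVec I x v y + extendVec I x w y
    simp only [extendVec]
    by_cases hy : y ∈ (trivializationAt E (TangentSpace I : M → Type _) x).baseSet
    · have h2 := ((trivializationAt E (TangentSpace I : M → Type _) x).symmₗ ℝ y).map_add
      simp only [Trivialization.symmₗ_apply _ hy] at h2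
      simp only [FiberBundle.extend]
      rw [h, h2, smul_add]
    · rw [image_eq_zero_of_notMem_tsupport fun h => hy ((exists_bump (I := I) x).choose_spec h)]
      simp
  map_smul' r v := by
    ext y
    have hx := FiberBundle.mem_baseSet_trivializationAt E (TangentSpace I : M → Type _) x
    have h := ((trivializationAt E (TangentSpace I : M → Type _) x).linear ℝ hx).map_smul r v
    change extendVec I x (r • v) y = r • extendVec I x v y
    simp only [extendVec]
    by_cases hy : y ∈ (trivializationAt E (TangentSpace I : M → Type _) x).baseSet
    · have h2 := ((trivializationAt E (TangentSpace I : M → Type _) x).symmₗ ℝ y).map_smul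
      simp only [Trivialization.symmₗ_apply _ hy] at h2
      simp only [FiberBundle.extend]
      rw [h, h2, smul_comm]
    · rw [image_eq_zero_of_notMem_tsupport fun h => hy ((exists_bump (I := I) x).choose_spec h)]
      simp

theorem extendSec_self (x : M) (v : TangentSpace I x) : extendSec I x v x = v :=
  extendVec_self x v

/-- `∇_X Y` as a smooth section. -/
def nablaSec (cov : CovariantDerivative I E (TangentSpace I : M → Type _))
    (hcov : CovariantDerivative.ContMDiffCovariantDerivative cov ∞)
    (X Y : VectorFields I M) :
    VectorFields I M :=
  ⟨nabla cov X Y, contMDiff_nabla cov hcov X Y⟩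

theorem contMDiff_mlieBracket (X Y : VectorFields I M) :
    ContMDiff I (I.prod 𝓘(ℝ, E)) ∞
      (fun y => TotalSpace.mk' E (E := (TangentSpace I : M → Type _)) y
        (VectorField.mlieBracket I X Y y)) := by
  have : IsManifold I (minSmoothness ℝ 2) M := isManifold_minSmoothness 2
  have : IsManifold I (((⊤ : ℕ∞) : WithTop ℕ∞) + 1) M := by simpa using! ‹IsManifold I ∞ M›
  exact ContDiff.mlieBracket_vectorField (m := ⊤) (n := ⊤) X.contMDiff Y.contMDiff (by simp)

/-- The Lie bracket as a smooth section. -/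
def lieSec (X Y : VectorFields I M) :
    VectorFields I M :=
  ⟨VectorField.mlieBracket I X Y, contMDiff_mlieBracket X Y⟩

theorem lieBracket_derivation (X Y : VectorFields I M)
    (f : M → ℝ) (hf : ContMDiff I 𝓘(ℝ, ℝ) ∞ f) (x : M) :
    mvfderiv I f x (VectorField.mlieBracket I X Y x)
      = mvfderiv I (fun y => mvfderiv I f y (Y y)) x (X x)
        - mvfderiv I (fun y => mvfderiv I f y (X y)) x (Y x) := by
  by_cases hv : ∀ v : TangentSpace I x, v = 0
  · rw [hv (VectorField.mlieBracket I X Y x), hv (X x), hv (Y x)]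
    simp
  push Not at hv
  obtain ⟨v, hv⟩ := hv
  let Z := extendSec I x v
  have hZx : Z x = v := extendSec_self x v
  have m2 : IsManifold I (minSmoothness ℝ 2) M := isManifold_minSmoothness 2
  have m3 : IsManifold I (minSmoothness ℝ 3) M := isManifold_minSmoothness 3
  let fZ : VectorFields I M := ⟨f • ⇑Z, hf.smul_section Z.contMDiff⟩
  have hmd : ∀ (S : VectorFields I M) (y : M),
      MDifferentiableAt I (I.prod 𝓘(ℝ, E))
        (fun y => TotalSpace.mk' E (E := (TangentSpace I : M → Type _)) y (S y)) y := fun S y =>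
    (S.contMDiff y).mdifferentiableAt (by simp)
  have hfd : ∀ g : M → ℝ, ContMDiff I 𝓘(ℝ, ℝ) ∞ g → ∀ y, MDifferentiableAt I 𝓘(ℝ, ℝ) g y :=
    fun g hg y => (hg y).mdifferentiableAt (by simp)
  have hc : ∀ (S : VectorFields I M),
      ContMDiffAt I (I.prod 𝓘(ℝ, E)) (minSmoothness ℝ 2)
        (fun y => TotalSpace.mk' E (E := (TangentSpace I : M → Type _)) y (S y)) x := fun S => by
    rw [minSmoothness_of_isRCLikeNormedField]
    exact contMDiffAt_infty.1 (S.contMDiff x) 2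
  have J1 := VectorField.leibniz_identity_mlieBracket_apply (hc X) (hc Y) (hc fZ)
  have J2 := VectorField.leibniz_identity_mlieBracket_apply (hc X) (hc Y) (hc Z)
  have hbr : ∀ (S T : VectorFields I M) (g : M → ℝ),
      ContMDiff I 𝓘(ℝ, ℝ) ∞ g → VectorField.mlieBracket I S (g • ⇑T)
        = (fun y => mvfderiv I g y (S y)) • ⇑T + g • VectorField.mlieBracket I S T := by
    intro S T g hg
    ext y
    exact VectorField.mlieBracket_smul_right (hfd g hg y) (hmd T y)
  have hbr2 : ∀ (S T : VectorFields I M),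
      VectorField.mlieBracket I S (VectorField.mlieBracket I T fZ) x
        = mvfderiv I (fun y => mvfderiv I f y (T y)) x (S x) • Z x
          + mvfderiv I f x (T x) • VectorField.mlieBracket I S Z x
          + (mvfderiv I f x (S x) • VectorField.mlieBracket I T Z x
          + f x • VectorField.mlieBracket I S (VectorField.mlieBracket I T Z) x) := by
    intro S T
    have hT := contMDiff_dirDeriv T f hf
    have e1 : VectorField.mlieBracket I T fZ
        = (fun y => mvfderiv I f y (T y)) • ⇑Z + f • ⇑(lieSec T Z) := hbr T Z f hf
    have e2 : VectorField.mlieBracket I S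
        ((fun y => mvfderiv I f y (T y)) • ⇑Z + f • ⇑(lieSec T Z)) x
        = VectorField.mlieBracket I S ((fun y => mvfderiv I f y (T y)) • ⇑Z) x
          + VectorField.mlieBracket I S (f • ⇑(lieSec T Z)) x :=
      VectorField.mlieBracket_add_right
        (hmd ⟨(fun y => mvfderiv I f y (T y)) • ⇑Z, hT.smul_section Z.contMDiff⟩ x)
        (hmd ⟨f • ⇑(lieSec T Z), hf.smul_section (lieSec T Z).contMDiff⟩ x)
    rw [e1, e2, hbr S Z _ hT, hbr S (lieSec T Z) f hf]
    rfl
  have e3 : VectorField.mlieBracket I (VectorField.mlieBracket I X Y) fZ x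
      = mvfderiv I f x (VectorField.mlieBracket I X Y x) • Z x
        + f x • VectorField.mlieBracket I (VectorField.mlieBracket I X Y) Z x :=
    congrFun (hbr (lieSec X Y) Z f hf) x
  rw [hbr2 X Y, hbr2 Y X, e3, J2, hZx] at J1
  have key : (mvfderiv I (fun y => mvfderiv I f y (Y y)) x (X x)) • v
      = (mvfderiv I f x (VectorField.mlieBracket I X Y x)
        + mvfderiv I (fun y => mvfderiv I f y (X y)) x (Y x)) • v := by
    have := sub_eq_zero.2 J1
    rw [← sub_eq_zero, ← this]
    module
  have := smul_left_injective ℝ hv key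
  linarith

end Extension

section RiemannCurvature

variable {E : Type*} [NormedAddCommGroup E] [NormedSpace ℝ E] [FiniteDimensional ℝ E]
  {H : Type*} [TopologicalSpace H] {I : ModelWithCorners ℝ E H}
  {M : Type*} [TopologicalSpace M] [ChartedSpace H M] [IsManifold I ∞ M] [T2Space M]
  [RiemannianBundle (fun (x : M) ↦ TangentSpace I x)]
  [IsContMDiffRiemannianBundle I ∞ E (fun (x : M) ↦ TangentSpace I x)]

namespace LeviCivitaConnection

theorem curvature_add (D : LeviCivitaConnection I M)
    (X Y Z W : VectorFields I M) :
    curvature D.cov X Y ⇑(Z + W) = curvature D.cov X Y Z + curvature D.cov X Y W := by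
  have e : ∀ A B : VectorFields I M,
      nabla D.cov A (nabla D.cov B ⇑(Z + W))
        = nabla D.cov A (nabla D.cov B Z) + nabla D.cov A (nabla D.cov B W) := fun A B => by
    rw [nabla_add D.cov B]
    exact nabla_add D.cov A (nablaSec D.cov D.smooth B Z) (nablaSec D.cov D.smooth B W)
  have e' : nabla D.cov (VectorField.mlieBracket I X Y) ⇑(Z + W) = _ := nabla_add D.cov (lieSec X Y) Z W
  simp only [curvature]
  rw [e, e, e']
  simp only [lieSec, ContMDiffSection.coeFn_mk]
  abel

theorem curvature_smul (D : LeviCivitaConnection I M)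
    (X Y Z : VectorFields I M) (r : ℝ) :
    curvature D.cov X Y ⇑(r • Z) = r • curvature D.cov X Y Z := by
  have e : ∀ A B : VectorFields I M,
      nabla D.cov A (nabla D.cov B ⇑(r • Z)) = r • nabla D.cov A (nabla D.cov B Z) := fun A B => by
    rw [nabla_smul D.cov B]
    exact nabla_smul D.cov A (nablaSec D.cov D.smooth B Z) r
  have e' : nabla D.cov (VectorField.mlieBracket I X Y) ⇑(r • Z) = _ := nabla_smul D.cov (lieSec X Y) Z r
  simp only [curvature]
  rw [e, e, e', smul_sub, smul_sub]
  rfl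

/-- The Riemann curvature `R^g(X, Y)` at the point `x`, as an endomorphism of `T_x M`:
it sends `v` to the value at `x` of `R^g(X, Y)` applied to a smooth vector field through `v`. -/
def curvatureAt (D : LeviCivitaConnection I M)
    (X Y : VectorFields I M) (x : M) : Module.End ℝ (TangentSpace I x) where
  toFun v := curvature D.cov X Y (extendSec I x v) x
  map_add' v w := by rw [map_add, D.curvature_add]; rfl
  map_smul' r v := by rw [map_smul, D.curvature_smul]; rfl

theorem curvature_skew (D : LeviCivitaConnection I M)
    (X Y Z W : VectorFields I M) (x : M) :
    inner ℝ (curvature D.cov X Y Z x) (W x) = - inner ℝ (Z x) (curvature D.cov X Y W x) := by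
  have hin : ∀ S T : VectorFields I M,
      ContMDiff I 𝓘(ℝ, ℝ) ∞ (fun y => inner ℝ (S y) (T y)) := fun S T =>
    ContMDiff.inner_bundle S.contMDiff T.contMDiff
  have hd : ∀ A B : VectorFields I M,
      mvfderiv I (fun y => mvfderiv I (fun y => inner ℝ (Z y) (W y)) y (B y)) x (A x)
        = (inner ℝ (nabla D.cov A (nabla D.cov B Z) x) (W x)
            + inner ℝ (nabla D.cov B Z x) (nabla D.cov A W x))
          + (inner ℝ (nabla D.cov A Z x) (nabla D.cov B W x)
            + inner ℝ (Z x) (nabla D.cov A (nabla D.cov B W) x)) := by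
    intro A B
    have e1 : (fun y => mvfderiv I (fun y => inner ℝ (Z y) (W y)) y (B y))
        = (fun y => inner ℝ (nablaSec D.cov D.smooth B Z y) (W y))
          + fun y => inner ℝ (Z y) (nablaSec D.cov D.smooth B W y) := by
      ext y
      exact D.metric B Z W y
    rw [e1, mvfderiv_add ((hin _ _ x).mdifferentiableAt (by simp))
      ((hin _ _ x).mdifferentiableAt (by simp))]
    have k1 := D.metric A (nablaSec D.cov D.smooth B Z) W x
    have k2 := D.metric A Z (nablaSec D.cov D.smooth B W) x
    exact congrArg₂ (· + ·) k1 k2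
  have h := lieBracket_derivation X Y _ (hin Z W) x
  rw [hd X Y, hd Y X] at h
  have h2 := D.metric (lieSec X Y) Z W x
  have h3 := h2.symm.trans h
  simp only [curvature, Pi.sub_apply, inner_sub_left, inner_sub_right]
  simp only [lieSec, ContMDiffSection.coeFn_mk] at h3
  linarith

/-- The Riemann curvature `R^g(X, Y)` at the point `x`, acting on covectors through the musical
isomorphism, as an element of the Lie algebra `so(T_x^* M)`. -/
def curvatureSo (D : LeviCivitaConnection I M)
    (X Y : VectorFields I M) (x : M) :
    (cometric I x).skewAdjointSubmodule :=
  ⟨(flat I x).conj (D.curvatureAt X Y x), by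
    rw [LinearMap.mem_skewAdjointSubmodule]
    intro α β
    obtain ⟨v, rfl⟩ := (flat I x).surjective α
    obtain ⟨w, rfl⟩ := (flat I x).surjective β
    have h := D.curvature_skew X Y (extendSec I x v) (extendSec I x w) x
    rw [extendSec_self, extendSec_self] at h
    simpa [cometric_apply, LinearEquiv.conj_apply, curvatureAt] using! h⟩

end LeviCivitaConnection

end RiemannCurvature

section Dirac

variable {E : Type*} [NormedAddCommGroup E] [NormedSpace ℝ E] [FiniteDimensional ℝ E]
  {H : Type*} [TopologicalSpace H] {I : ModelWithCorners ℝ E H}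
  {M : Type*} [TopologicalSpace M] [ChartedSpace H M] [IsManifold I ∞ M]
  [RiemannianBundle (fun (x : M) ↦ TangentSpace I x)]
  [IsContMDiffRiemannianBundle I ∞ E (fun (x : M) ↦ TangentSpace I x)]
  {F : Type*} [NormedAddCommGroup F] [NormedSpace ℂ F]
  {V : M → Type*} [TopologicalSpace (TotalSpace F V)]
  [∀ x, AddCommGroup (V x)] [∀ x, Module ℂ (V x)] [∀ x, TopologicalSpace (V x)]
  [∀ x, IsTopologicalAddGroup (V x)] [∀ x, ContinuousSMul ℝ (V x)]
  [FiberBundle F V]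

/-- A complex vector bundle is a real vector bundle. -/
instance vectorBundleReal [VectorBundle ℂ F V] : VectorBundle ℝ F V where
  trivialization_linear' e _ :=
    { linear := fun b hb =>
        ⟨fun x y => (Trivialization.linear ℂ e hb).map_add x y, fun r x => by
          have := (Trivialization.linear ℂ e hb).map_smul (r : ℂ) x
          simpa using! this⟩ }
  continuousOn_coordChange' e e' _ _ := by
    have h := continuousOn_coordChange ℂ e e'
    let _ : ∀ e : Trivialization F (π F V), ∀ [MemTrivializationAtlas e], e.IsLinear ℝ := fun e _ =>
      { linear := fun b hb =>
          ⟨fun x y => (Trivialization.linear ℂ e hb).map_add x y, fun r x => by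
            have := (Trivialization.linear ℂ e hb).map_smul (r : ℂ) x
            simpa using! this⟩ }
    have h2 := (ContinuousLinearMap.restrictScalarsL ℂ F F ℝ ℝ).continuous.comp_continuousOn h
    refine h2.congr ?_
    intro b hb
    ext v
    simp [Trivialization.coordChangeL_apply, hb]

variable [VectorBundle ℂ F V]

variable (I F V) in
/-- A Clifford module over a Riemannian manifold `M`: a `ℤ/2`-graded complex vector bundle `V`
with a hermitian metric `h` and a Clifford multiplication `c` by covectors. -/
structure CliffordModule where
  /-- the grading involution: `+1` on the even part and `-1` on the odd part of the bundle -/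
  grading : ∀ x : M, V x →ₗ[ℂ] V x
  grading_sq : ∀ (x : M) (ψ : V x), grading x (grading x ψ) = ψ
  grading_smooth : ∀ ψ : Cₛ^∞⟮I; F, V⟯, ContMDiff I (I.prod 𝓘(ℝ, F)) ∞
    fun x => TotalSpace.mk' F x (grading x (ψ x))
  /-- the hermitian metric, complex linear in the first argument -/
  h : ∀ x : M, V x →ₗ[ℂ] V x →ₗ⋆[ℂ] ℂ
  h_hermitian : ∀ (x : M) (ψ φ : V x), h x φ ψ = starRingEnd ℂ (h x ψ φ)
  h_nondegenerate : ∀ (x : M) (ψ : V x), (∀ φ, h x ψ φ = 0) → ψ = 0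
  h_smooth : ∀ ψ φ : Cₛ^∞⟮I; F, V⟯, ContMDiff I 𝓘(ℝ, ℂ) ∞ fun x => h x (ψ x) (φ x)
  /-- Clifford multiplication by covectors -/
  c : ∀ x : M, (TangentSpace I x →L[ℝ] ℝ) →ₗ[ℝ] Module.End ℂ (V x)
  c_smooth : ∀ (θ : OneForms I M) (ψ : Cₛ^∞⟮I; F, V⟯), ContMDiff I (I.prod 𝓘(ℝ, F)) ∞
    fun x => TotalSpace.mk' F x (c x (θ x) (ψ x))
  c_clifford : ∀ (x : M) (α β : TangentSpace I x →L[ℝ] ℝ) (ψ : V x),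
    c x α (c x β ψ) + c x β (c x α ψ) = (-2 * cometric I x α β) • ψ
  c_skew : ∀ (x : M) (α : TangentSpace I x →L[ℝ] ℝ), cometric I x α α = 1 → ∀ ψ φ : V x,
    h x (c x α ψ) φ + h x ψ (c x α φ) = 0
  c_odd : ∀ (x : M) (α : TangentSpace I x →L[ℝ] ℝ) (ψ : V x),
    grading x (c x α ψ) = - c x α (grading x ψ)

/-- The Clifford multiplication `c(θ) ψ` of a section by a one-form. -/
def CliffordModule.mul (S : CliffordModule I F V) (θ : ∀ x : M, TangentSpace I x →L[ℝ] ℝ)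
    (ψ : ∀ x, V x) (x : M) : V x := S.c x (θ x) (ψ x)

/-- The extension of Clifford multiplication to the Clifford algebra of `T_x^* M`. -/
def CliffordModule.cl (S : CliffordModule I F V) (x : M) :
    Cl (cometric I x) →ₐ[ℝ] Module.End ℂ (V x) :=
  CliffordAlgebra.lift (cliffordForm (cometric I x)) ⟨S.c x, fun α => by
    ext ψ
    have h := S.c_clifford x α α ψ
    rw [← two_smul ℝ, mul_smul, neg_smul, ← smul_neg] at h
    have h2 := smul_right_injective (V x) (two_ne_zero' ℝ) h
    rw [cliffordForm_apply]
    simpa [neg_smul, Algebra.algebraMap_eq_smul_one] using! h2⟩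

variable [ContMDiffVectorBundle ∞ F V I]

variable (F V) in
/-- A Dirac bundle over a Riemannian manifold with Levi-Civita connection `D`: a Clifford module
with a Clifford connection, i.e. a metric connection satisfying
`∇_X (c(θ) ψ) = c(∇^g_X θ) ψ + c(θ) ∇_X ψ`. -/
structure DiracBundle (D : LeviCivitaConnection I M) extends CliffordModule I F V where
  /-- the Clifford connection `∇^E` -/
  conn : CovariantDerivative I F V
  conn_smooth : CovariantDerivative.ContMDiffCovariantDerivative conn ∞
  conn_complex : ∀ (X : VectorFields I M) (ψ : Cₛ^∞⟮I; F, V⟯),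
    nabla conn X (fun y => Complex.I • ψ y) = fun x => Complex.I • nabla conn X ψ x
  conn_metric : ∀ (X : VectorFields I M) (ψ φ : Cₛ^∞⟮I; F, V⟯) (x : M),
    mvfderiv I (fun y => h y (ψ y) (φ y)) x (X x)
      = h x (nabla conn X ψ x) (φ x) + h x (ψ x) (nabla conn X φ x)
  conn_clifford : ∀ (X : VectorFields I M) (θ : OneForms I M) (ψ : Cₛ^∞⟮I; F, V⟯),
    nabla conn X (toCliffordModule.mul θ ψ)
      = toCliffordModule.mul (cotNabla D.cov X θ) ψ + toCliffordModule.mul θ (nabla conn X ψ)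

namespace DiracBundle

variable [T2Space M] {D : LeviCivitaConnection I M}

/-- The endomorphism `R^E(X, Y) = c(ρ_*⁻¹(R^g(X, Y)))` at a point. -/
def riemannPart (S : DiracBundle F V D) (X Y : VectorFields I M) (x : M) :
    Module.End ℂ (V x) :=
  S.cl x ((rhoStar (cometric I x) (cometric_isSymm x) (cometric_nondegenerate x)).symm
    (D.curvatureSo X Y x) : Cl (cometric I x))

/-- The twisting curvature `F^{E/S}(X, Y) = F^{∇^E}(X, Y) - R^E(X, Y)`, acting on sections. -/
def twistingCurvature (S : DiracBundle F V D) (X Y : VectorFields I M) (ψ : ∀ x, V x) (x : M) :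
    V x :=
  curvature S.conn X Y ψ x - S.riemannPart X Y x (ψ x)

end DiracBundle

end Dirac

end DiracGeom

end

/-!
The operators `F^{∇^E}(X, Y)` and `R^E(X, Y) = c(ρ_*⁻¹(R^g(X, Y)))` have the same commutator with
Clifford multiplication, namely `[·, c(θ)] = c(R^g(X, Y) θ)`, so their difference, the twisting
curvature, commutes with `c(θ)`.

For `F^{∇^E}` (`DiracBundle.curvature_mul`) one applies the rule
`∇_X (c(θ) ψ) = c(∇_X θ) ψ + c(θ) ∇_X ψ` twice and antisymmetrises. The rule is available for smooth
one-forms only, so it must be known that `∇_Y θ = ♭(∇_Y ♯θ)` is smooth; this comes down to the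
smoothness of `♯θ` (`contMDiff_sharp`), obtained by inverting the smooth bundle map `♭`. The outcome
involves the value at `x` of `R^g(X, Y)` applied to the field `♯θ`, whereas the twisting curvature
uses the endomorphism `R^g(X, Y)` of `T_x M`, defined through an extension of tangent vectors; the
two agree by `LeviCivitaConnection.curvature_eq_curvatureAt`.

For `R^E` (`DiracBundle.riemannPart_c`) the commutator is computed in the Clifford algebra, where
`[a, α] = ρ_*(a) α` for `a ∈ spin(T_x^*M)`.
-/

noncomputable section

namespace DiracGeom

/-! ### Inverting smooth bundle maps -/

section InverseBundleMap

variable {E : Type*} [NormedAddCommGroup E] [NormedSpace ℝ E]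
  {H : Type*} [TopologicalSpace H] {I : ModelWithCorners ℝ E H}
  {M : Type*} [TopologicalSpace M] [ChartedSpace H M]
  {F₁ : Type*} [NormedAddCommGroup F₁] [NormedSpace ℝ F₁] [CompleteSpace F₁]
  {V₁ : M → Type*} [TopologicalSpace (TotalSpace F₁ V₁)]
  [∀ x, AddCommGroup (V₁ x)] [∀ x, Module ℝ (V₁ x)] [∀ x, TopologicalSpace (V₁ x)]
  [FiberBundle F₁ V₁] [VectorBundle ℝ F₁ V₁]
  {F₂ : Type*} [NormedAddCommGroup F₂] [NormedSpace ℝ F₂]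
  {V₂ : M → Type*} [TopologicalSpace (TotalSpace F₂ V₂)]
  [∀ x, AddCommGroup (V₂ x)] [∀ x, Module ℝ (V₂ x)] [∀ x, TopologicalSpace (V₂ x)]
  [∀ x, IsTopologicalAddGroup (V₂ x)] [∀ x, ContinuousSMul ℝ (V₂ x)]
  [FiberBundle F₂ V₂] [VectorBundle ℝ F₂ V₂]

/-- A section whose image under a smooth, fibrewise invertible bundle map is smooth is itself
smooth: in coordinates the bundle map is a smooth family of invertible operators, and inversion
of operators is smooth. -/
theorem contMDiff_of_clm_bundle_apply {n : WithTop ℕ∞} {φ : ∀ x, V₁ x →L[ℝ] V₂ x}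
    (hinv : ∀ x, (φ x).IsInvertible)
    (hφ : ContMDiff I (I.prod 𝓘(ℝ, F₁ →L[ℝ] F₂)) n
      fun x => TotalSpace.mk' (F₁ →L[ℝ] F₂) (E := fun x => V₁ x →L[ℝ] V₂ x) x (φ x))
    {σ : ∀ x, V₁ x}
    (hσ : ContMDiff I (I.prod 𝓘(ℝ, F₂)) n fun x => TotalSpace.mk' F₂ x (φ x (σ x))) :
    ContMDiff I (I.prod 𝓘(ℝ, F₁)) n fun x => TotalSpace.mk' F₁ x (σ x) := by
  intro x₀
  have hφ' := ((contMDiffAt_hom_bundle _).1 (hφ x₀)).2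
  have hσ' := ((contMDiffAt_totalSpace).1 (hσ x₀)).2
  refine contMDiffAt_totalSpace.2 ⟨contMDiffAt_id, ?_⟩
  have hcoord : ∀ x (h₁ : x ∈ (trivializationAt F₁ V₁ x₀).baseSet)
      (h₂ : x ∈ (trivializationAt F₂ V₂ x₀).baseSet),
      (ContinuousLinearMap.inCoordinates F₁ V₁ F₂ V₂ x₀ x x₀ x (φ x)).IsInvertible := by
    intro x h₁ h₂
    rw [ContinuousLinearMap.inCoordinates_eq h₁ h₂]
    exact ContinuousLinearMap.isInvertible_equiv.comp
      ((hinv x).comp ContinuousLinearMap.isInvertible_equiv)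
  have hinv₀ : ContMDiffAt I 𝓘(ℝ, F₂ →L[ℝ] F₁) n
      (fun x => (ContinuousLinearMap.inCoordinates F₁ V₁ F₂ V₂ x₀ x x₀ x (φ x)).inverse) x₀ :=
    ContMDiffAt.comp x₀ (g := ContinuousLinearMap.inverse)
      (hcoord x₀ (FiberBundle.mem_baseSet_trivializationAt' x₀)
        (FiberBundle.mem_baseSet_trivializationAt' x₀)).contDiffAt_map_inverse.contMDiffAt hφ'
  refine (hinv₀.clm_apply hσ').congr_of_eventuallyEq ?_
  filter_upwards [(trivializationAt F₁ V₁ x₀).open_baseSet.mem_nhds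
      (FiberBundle.mem_baseSet_trivializationAt' x₀),
    (trivializationAt F₂ V₂ x₀).open_baseSet.mem_nhds
      (FiberBundle.mem_baseSet_trivializationAt' x₀)] with x h₁ h₂
  refine ((hcoord x h₁ h₂).inverse_apply_eq.2 ?_).symm
  rw [ContinuousLinearMap.inCoordinates_eq h₁ h₂]
  simp [h₁]

end InverseBundleMap

/-! ### Smoothness of the musical isomorphisms -/

section Musical

variable {E : Type*} [NormedAddCommGroup E] [NormedSpace ℝ E] [FiniteDimensional ℝ E]
  {H : Type*} [TopologicalSpace H] {I : ModelWithCorners ℝ E H}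
  {M : Type*} [TopologicalSpace M] [ChartedSpace H M] [IsManifold I ∞ M]
  [RiemannianBundle (fun (x : M) ↦ TangentSpace I x)]
  [IsContMDiffRiemannianBundle I ∞ E (fun (x : M) ↦ TangentSpace I x)]

variable (I M) in
/-- The musical isomorphism `♭` is a smooth bundle map `TM → T^*M`. -/
theorem exists_contMDiff_flat : ∃ φ : ∀ x : M, TangentSpace I x →L[ℝ] TangentSpace I x →L[ℝ] ℝ,
    ContMDiff I (I.prod 𝓘(ℝ, E →L[ℝ] E →L[ℝ] ℝ)) ∞
      (fun x => TotalSpace.mk' (E →L[ℝ] E →L[ℝ] ℝ)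
        (E := fun x : M => TangentSpace I x →L[ℝ] TangentSpace I x →L[ℝ] ℝ) x (φ x)) ∧
    ∀ x v, φ x v = flat I x v := by
  obtain ⟨g, hg, hg'⟩ := IsContMDiffRiemannianBundle.exists_contMDiff (IB := I) (n := ∞) (F := E)
    (E := fun x : M => TangentSpace I x)
  exact ⟨g, hg, fun x v => by ext w; rw [flat_apply]; exact (hg' x v w).symm⟩

theorem contMDiff_flat (Z : VectorFields I M) :
    ContMDiff I (I.prod 𝓘(ℝ, E →L[ℝ] ℝ)) ∞
      fun x => TotalSpace.mk' (E →L[ℝ] ℝ) (E := fun x : M => TangentSpace I x →L[ℝ] ℝ) x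
        (flat I x (Z x)) := by
  obtain ⟨φ, hφ, hφ'⟩ := exists_contMDiff_flat I M
  simp only [← hφ']
  exact hφ.clm_bundle_apply Z.contMDiff

theorem contMDiff_sharp (θ : OneForms I M) :
    ContMDiff I (I.prod 𝓘(ℝ, E)) ∞
      fun x => TotalSpace.mk' E (E := (TangentSpace I : M → Type _)) x (sharp I θ x) := by
  obtain ⟨φ, hφ, hφ'⟩ := exists_contMDiff_flat I M
  refine contMDiff_of_clm_bundle_apply (fun x => ?_) hφ ?_
  · refine ⟨(InnerProductSpace.toDual ℝ (TangentSpace I x)).toContinuousLinearEquiv, ?_⟩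
    ext1 v
    exact (hφ' x v).symm
  · simp only [hφ', sharp, LinearEquiv.apply_symm_apply]
    exact θ.contMDiff

/-- `♭Z` as a smooth one-form. -/
def flatSec (Z : VectorFields I M) : OneForms I M := ⟨fun x => flat I x (Z x), contMDiff_flat Z⟩

/-- `♯θ` as a smooth vector field. -/
def sharpSec (θ : OneForms I M) : VectorFields I M := ⟨sharp I θ, contMDiff_sharp θ⟩

theorem sharpSec_flatSec (Z : VectorFields I M) : sharpSec (flatSec Z) = Z := by
  ext x
  exact (flat I x).symm_apply_apply (Z x)

/-- The covariant derivative `∇_X θ` of a one-form, as a smooth one-form. -/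
def cotNablaSec (D : LeviCivitaConnection I M) [T2Space M] (X : VectorFields I M)
    (θ : OneForms I M) : OneForms I M :=
  flatSec (nablaSec D.cov D.smooth X (sharpSec θ))

theorem coe_cotNablaSec (D : LeviCivitaConnection I M) [T2Space M] (X : VectorFields I M)
    (θ : OneForms I M) : ⇑(cotNablaSec D X θ) = cotNabla D.cov X θ := rfl

theorem sharpSec_cotNablaSec (D : LeviCivitaConnection I M) [T2Space M] (X : VectorFields I M)
    (θ : OneForms I M) :
    sharpSec (cotNablaSec D X θ) = nablaSec D.cov D.smooth X (sharpSec θ) :=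
  sharpSec_flatSec _

end Musical

/-! ### Pointwise values of the Riemann curvature -/

section RiemannCurvature

variable {E : Type*} [NormedAddCommGroup E] [NormedSpace ℝ E] [FiniteDimensional ℝ E]
  {H : Type*} [TopologicalSpace H] {I : ModelWithCorners ℝ E H}
  {M : Type*} [TopologicalSpace M] [ChartedSpace H M] [IsManifold I ∞ M] [T2Space M]
  [RiemannianBundle (fun (x : M) ↦ TangentSpace I x)]
  [IsContMDiffRiemannianBundle I ∞ E (fun (x : M) ↦ TangentSpace I x)]

/-- The value of `R^g(X, Y)Z` at `x` depends only on `Z x`. Skewness moves `R^g(X, Y)` onto a test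
field, after which `Z` enters only through its value at `x`. -/
theorem LeviCivitaConnection.curvature_eq_curvatureAt (D : LeviCivitaConnection I M)
    (X Y Z : VectorFields I M) (x : M) :
    curvature D.cov X Y Z x = D.curvatureAt X Y x (Z x) := by
  refine ext_inner_right ℝ fun w => ?_
  have h₁ := D.curvature_skew X Y Z (extendSec I x w) x
  have h₂ := D.curvature_skew X Y (extendSec I x (Z x)) (extendSec I x w) x
  rw [extendSec_self] at h₁ h₂
  rw [extendSec_self] at h₂
  exact h₁.trans h₂.symm

end RiemannCurvature

/-! ### Additivity of covariant derivatives -/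

section CovariantDerivative

variable {E : Type*} [NormedAddCommGroup E] [NormedSpace ℝ E]
  {H : Type*} [TopologicalSpace H] {I : ModelWithCorners ℝ E H}
  {M : Type*} [TopologicalSpace M] [ChartedSpace H M]
  {F : Type*} [NormedAddCommGroup F] [NormedSpace ℝ F]
  {V : M → Type*} [TopologicalSpace (TotalSpace F V)]
  [∀ x, AddCommGroup (V x)] [∀ x, Module ℝ (V x)] [∀ x, TopologicalSpace (V x)]
  [∀ x, IsTopologicalAddGroup (V x)] [∀ x, ContinuousSMul ℝ (V x)]
  [FiberBundle F V] [VectorBundle ℝ F V]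

theorem nabla_add_section (cov : CovariantDerivative I F V) (X : ∀ x : M, TangentSpace I x)
    (σ τ : Cₛ^∞⟮I; F, V⟯) : nabla cov X ⇑(σ + τ) = nabla cov X σ + nabla cov X τ := by
  ext x
  have h := cov.isCovariantDerivativeOnUniv.add (x := x) (σ := σ) (σ' := τ)
    ((σ.contMDiff x).mdifferentiableAt (by simp)) ((τ.contMDiff x).mdifferentiableAt (by simp))
  simpa [nabla] using! congrArg (fun L => L (X x)) h

end CovariantDerivative

/-! ### Clifford multiplication by the spin Lie algebra -/

section CliffordModule

variable {E : Type*} [NormedAddCommGroup E] [NormedSpace ℝ E] [FiniteDimensional ℝ E]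
  {H : Type*} [TopologicalSpace H] {I : ModelWithCorners ℝ E H}
  {M : Type*} [TopologicalSpace M] [ChartedSpace H M] [IsManifold I ∞ M]
  [RiemannianBundle (fun (x : M) ↦ TangentSpace I x)]
  {F : Type*} [NormedAddCommGroup F] [NormedSpace ℂ F]
  {V : M → Type*} [TopologicalSpace (TotalSpace F V)]
  [∀ x, AddCommGroup (V x)] [∀ x, Module ℂ (V x)] [∀ x, TopologicalSpace (V x)]
  [FiberBundle F V]

theorem CliffordModule.cl_clι (S : CliffordModule I F V) (x : M)
    (α : TangentSpace I x →L[ℝ] ℝ) : S.cl x (clι (cometric I x) α) = S.c x α :=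
  CliffordAlgebra.lift_ι_apply _ _ _

/-- On `spin(T_x^*M)`, the commutator with `c(α)` is Clifford multiplication by `ρ_*(a) α`. -/
theorem CliffordModule.cl_lie_c (S : CliffordModule I F V) (x : M)
    (a : spinLie (cometric I x)) (α : TangentSpace I x →L[ℝ] ℝ) :
    ⁅S.cl x (a : Cl (cometric I x)), S.c x α⁆
      = S.c x ((rhoStar (cometric I x) (cometric_isSymm x) (cometric_nondegenerate x) a :
          Module.End ℝ (TangentSpace I x →L[ℝ] ℝ)) α) := by
  rw [← S.cl_clι, ← S.cl_clι, clι_rhoStar, Ring.lie_def, Ring.lie_def, map_sub, map_mul, map_mul]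

end CliffordModule

/-! ### Curvature of a Clifford connection -/

section Dirac

variable {E : Type*} [NormedAddCommGroup E] [NormedSpace ℝ E] [FiniteDimensional ℝ E]
  {H : Type*} [TopologicalSpace H] {I : ModelWithCorners ℝ E H}
  {M : Type*} [TopologicalSpace M] [ChartedSpace H M] [IsManifold I ∞ M]
  [RiemannianBundle (fun (x : M) ↦ TangentSpace I x)]
  [IsContMDiffRiemannianBundle I ∞ E (fun (x : M) ↦ TangentSpace I x)]
  {F : Type*} [NormedAddCommGroup F] [NormedSpace ℂ F]
  {V : M → Type*} [TopologicalSpace (TotalSpace F V)]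
  [∀ x, AddCommGroup (V x)] [∀ x, Module ℂ (V x)] [∀ x, TopologicalSpace (V x)]
  [∀ x, IsTopologicalAddGroup (V x)] [∀ x, ContinuousSMul ℝ (V x)]
  [FiberBundle F V] [VectorBundle ℂ F V]

/-- The Clifford product `c(θ) ψ` as a smooth section. -/
def CliffordModule.mulSec (S : CliffordModule I F V) (θ : OneForms I M) (ψ : Cₛ^∞⟮I; F, V⟯) :
    Cₛ^∞⟮I; F, V⟯ :=
  ⟨S.mul θ ψ, S.c_smooth θ ψ⟩

namespace DiracBundle

variable [T2Space M] {D : LeviCivitaConnection I M}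

/-- `∇^E_X ψ` as a smooth section. -/
def connSec (S : DiracBundle F V D) (X : VectorFields I M) (ψ : Cₛ^∞⟮I; F, V⟯) :
    Cₛ^∞⟮I; F, V⟯ :=
  ⟨nabla S.conn X ψ, by
    have h := S.conn_smooth.contMDiff.contMDiff (σ := ψ) (by
      rw [contMDiffOn_univ]
      exact ψ.contMDiff)
    rw [contMDiffOn_univ] at h
    exact ContMDiff.clm_bundle_apply h X.contMDiff⟩

/-- The second-order Leibniz rule for `∇^E_X ∇^E_Y` and Clifford multiplication. -/
theorem conn_conn_mul (S : DiracBundle F V D) (X Y : VectorFields I M) (θ : OneForms I M)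
    (ψ : Cₛ^∞⟮I; F, V⟯) :
    nabla S.conn X (nabla S.conn Y (S.toCliffordModule.mul θ ψ))
      = S.toCliffordModule.mul (cotNablaSec D X (cotNablaSec D Y θ)) ψ
        + S.toCliffordModule.mul (cotNablaSec D Y θ) (nabla S.conn X ψ)
        + (S.toCliffordModule.mul (cotNablaSec D X θ) (nabla S.conn Y ψ)
          + S.toCliffordModule.mul θ (nabla S.conn X (nabla S.conn Y ψ))) := by
  have h := nabla_add_section S.conn X (S.toCliffordModule.mulSec (cotNablaSec D Y θ) ψ)
    (S.toCliffordModule.mulSec θ (S.connSec Y ψ))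
  rw [S.conn_clifford Y θ ψ]
  refine h.trans (congrArg₂ (· + ·) ?_ ?_)
  · exact S.conn_clifford X (cotNablaSec D Y θ) ψ
  · exact S.conn_clifford X θ (S.connSec Y ψ)

/-- The curvature of a Clifford connection satisfies
`F(X, Y)(c(θ) ψ) = c(R^g(X, Y) θ) ψ + c(θ) F(X, Y) ψ`: the mixed first-order terms of the two
second derivatives cancel. -/
theorem curvature_mul (S : DiracBundle F V D) (X Y : VectorFields I M) (θ : OneForms I M)
    (ψ : Cₛ^∞⟮I; F, V⟯) (x : M) :
    curvature S.conn X Y (S.toCliffordModule.mul θ ψ) x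
      = S.c x ((D.curvatureSo X Y x : Module.End ℝ (TangentSpace I x →L[ℝ] ℝ)) (θ x)) (ψ x)
        + S.c x (θ x) (curvature S.conn X Y ψ x) := by
  have hcc : ∀ A B : VectorFields I M, cotNablaSec D A (cotNablaSec D B θ)
      = flatSec (nablaSec D.cov D.smooth A (nablaSec D.cov D.smooth B (sharpSec θ))) := fun A B => by
    rw [← sharpSec_cotNablaSec]
    rfl
  have hR : (D.curvatureSo X Y x : Module.End ℝ (TangentSpace I x →L[ℝ] ℝ)) (θ x)
      = cotNablaSec D X (cotNablaSec D Y θ) x - cotNablaSec D Y (cotNablaSec D X θ) x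
        - cotNablaSec D (lieSec X Y) θ x := by
    have h := congrArg (flat I x) (D.curvature_eq_curvatureAt X Y (sharpSec θ) x)
    refine h.symm.trans ?_
    simp only [curvature, Pi.sub_apply, map_sub]
    rw [hcc X Y, hcc Y X]
    rfl
  have hL := congrFun (S.conn_clifford (lieSec X Y) θ ψ) x
  rw [← coe_cotNablaSec] at hL
  have hL' : nabla S.conn (VectorField.mlieBracket I X Y) (S.toCliffordModule.mul θ ψ) x
      = S.c x (cotNablaSec D (lieSec X Y) θ x) (ψ x)
        + S.c x (θ x) (nabla S.conn (VectorField.mlieBracket I X Y) ψ x) := hL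
  rw [hR]
  simp only [curvature, Pi.sub_apply, map_sub, LinearMap.sub_apply, conn_conn_mul, Pi.add_apply,
    CliffordModule.mul, hL']
  abel

/-- `R^E(X, Y) = c(ρ_*⁻¹(R^g(X, Y)))` obeys the same commutation rule with `c(α)` as the curvature
of the Clifford connection. -/
theorem riemannPart_c (S : DiracBundle F V D) (X Y : VectorFields I M) (x : M)
    (α : TangentSpace I x →L[ℝ] ℝ) (v : V x) :
    S.riemannPart X Y x (S.c x α v)
      = S.c x ((D.curvatureSo X Y x : Module.End ℝ (TangentSpace I x →L[ℝ] ℝ)) α) v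
        + S.c x α (S.riemannPart X Y x v) := by
  have h := S.cl_lie_c x ((rhoStar (cometric I x) (cometric_isSymm x)
    (cometric_nondegenerate x)).symm (D.curvatureSo X Y x)) α
  rw [LinearEquiv.apply_symm_apply] at h
  exact sub_eq_iff_eq_add.1 (LinearMap.congr_fun h v)

end DiracBundle

end Dirac

end DiracGeom

end

theorem mainTheorem12 (n : ℕ)
    {M : Type*} [TopologicalSpace M] [T2Space M] [ChartedSpace (EuclideanSpace ℝ (Fin n)) M]
    [IsManifold (𝓡 n) ∞ M]
    [RiemannianBundle (fun x : M => TangentSpace (𝓡 n) x)]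
    [IsContMDiffRiemannianBundle (𝓡 n) ∞ (EuclideanSpace ℝ (Fin n))
      (fun x : M => TangentSpace (𝓡 n) x)]
    {F : Type*} [NormedAddCommGroup F] [NormedSpace ℂ F] [FiniteDimensional ℂ F]
    {V : M → Type*} [TopologicalSpace (TotalSpace F V)]
    [∀ x, AddCommGroup (V x)] [∀ x, Module ℂ (V x)] [∀ x, TopologicalSpace (V x)]
    [∀ x, IsTopologicalAddGroup (V x)] [∀ x, ContinuousSMul ℝ (V x)]
    [FiberBundle F V] [VectorBundle ℂ F V] [ContMDiffVectorBundle ∞ F V (𝓡 n)]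
    (D : DiracGeom.LeviCivitaConnection (𝓡 n) M) (S : DiracGeom.DiracBundle F V D)
    (X Y : DiracGeom.VectorFields (𝓡 n) M) (θ : DiracGeom.OneForms (𝓡 n) M)
    (ψ : Cₛ^∞⟮𝓡 n; F, V⟯) :
    S.twistingCurvature X Y (S.toCliffordModule.mul θ ψ)
      = S.toCliffordModule.mul θ (S.twistingCurvature X Y ψ) := by
  ext x
  change DiracGeom.curvature S.conn X Y (S.toCliffordModule.mul θ ψ) x
      - S.riemannPart X Y x (S.c x (θ x) (ψ x))
    = S.c x (θ x) (DiracGeom.curvature S.conn X Y ψ x - S.riemannPart X Y x (ψ x))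
  rw [S.curvature_mul, S.riemannPart_c, map_sub, add_sub_add_left_eq_sub]
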